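/- **Theorem (Curvature 12 Umlaufsatz).** Let $X$ be the flat triangular lattice graph with vertices $\{k(1,0)+l(1,\sqrt3)/2 : k,l\in\mathbb Z\}$ and edges the pairs at Euclidean distance $1$. For every finite, smooth and simply connected domain $G$ in $X$, with set of boundary points $\delta G$, $$\sum_{p\in\delta G}K(p)=12,\qquad K(p)=2|S_1(p)|-|S_2(p)|.$$ Here the following terminology is used for a subgraph $G$ of $X$. * The sphere $S_r(p)$ in $G$ is the graph whose vertices are the vertices of $G$ at geodesic distance $r$ from $p$ *within $G$*, and whose edges are the edges of $G$ between them; $|S_r(p)|$ is its number of *edges*. * A point is $0$-dimensional in a graph if it has no neighbour there; it is $(n+1)$-dimensional if its unit sphere in that graph is non-empty and every point of this sphere is $n$-dimensional in it. A graph is $n$-dimensional if all its points are. * A point $p$ of $G$ is *interior* if its unit sphere in $G$ equals its unit sphere in $X$; it is a *boundary point* if it is not interior but has an interior point as a neighbour in $G$. * $G$ is a *domain* if (i) $G$ is two-dimensional; (ii) every point of $G$ is an interior or a boundary point; (iii) the graph induced by $G$ on the boundary points is one-dimensional; (iv) any two vertices of $G$ at distance $1$ in $X$ are joined by an edge of $G$;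 (v) any two distinct interior points with a common neighbouring boundary point are adjacent or are both adjacent to a third interior point. * A domain $G$ is *smooth* if its complement, meaning the subgraph of $X$ induced on all points that are not interior points of $G$, is a domain too. * A domain $G$ is *simply connected* if it is connected and every closed curve $x_0,x_1,\dots,x_n=x_0$ of interior points with $d(x_i,x_{i+1})=1$ can be deformed to a constant sequence by finitely many elementary steps $(x_1,\dots,x_n)\to(y_1,\dots,y_n)$ with $\sum_i d(x_i,y_i)=1$; all sequences occurring are closed sequences of interior points in which consecutive points are equal or adjacent. -/

import Mathlib

/-- The flat triangular lattice `X`. The pair `(k, l)` stands for the point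
`k • (1, 0) + l • (1/2, √3/2)` of the plane. Two vertices are joined exactly when their Euclidean
distance is `1`; the squared Euclidean length of the vector `(a, b)` is `a² + ab + b²`. -/
def triLattice : SimpleGraph (ℤ × ℤ) where
  Adj p q := (q.1 - p.1) ^ 2 + (q.1 - p.1) * (q.2 - p.2) + (q.2 - p.2) ^ 2 = 1
  symm := ⟨fun p q h => by linear_combination h⟩
  loopless := ⟨fun p h => by simp at h⟩

namespace TriDomain

/-- The sphere `S_r(p)` in the graph `G`: its vertices are the vertices of `G` whose geodesic
distance to `p` within `G` is `r`, its edges are the edges of `G` between such vertices. -/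
def sphere (G : triLattice.Subgraph) (p : ℤ × ℤ) (r : ℕ) : triLattice.Subgraph :=
  G.induce {q | q ∈ G.verts ∧ G.spanningCoe.edist p q = (r : ℕ∞)}

/-- The vertex `p` of `G` has dimension `n`: a vertex has dimension `0` if it has no neighbour, and
dimension `n + 1` if its unit sphere is non-empty and consists of points of dimension `n` in that
sphere. (A vertex need not have a dimension.) -/
def HasPointDim : ℕ → triLattice.Subgraph → ℤ × ℤ → Prop
  | 0, G, p => ∀ q, ¬ G.Adj p q
  | n + 1, G, p => (sphere G p 1).verts.Nonempty ∧
      ∀ q ∈ (sphere G p 1).verts, HasPointDim n (sphere G p 1) q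

/-- The graph `G` is `n`-dimensional: each of its vertices is `n`-dimensional. -/
def HasDim (n : ℕ) (G : triLattice.Subgraph) : Prop :=
  ∀ p ∈ G.verts, HasPointDim n G p

/-- The interior points of `G`: the unit sphere in `G` is the unit sphere in the lattice. -/
def interior (G : triLattice.Subgraph) : Set (ℤ × ℤ) :=
  {p | p ∈ G.verts ∧ sphere G p 1 = sphere ⊤ p 1}

/-- The boundary points of `G`: non-interior points with an interior neighbour in `G`. -/
def boundary (G : triLattice.Subgraph) : Set (ℤ × ℤ) :=
  {p | p ∈ G.verts ∧ p ∉ interior G ∧ ∃ q ∈ interior G, G.Adj p q}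

/-- Domains in the triangular lattice. -/
structure IsDomain (G : triLattice.Subgraph) : Prop where
  two_dim : HasDim 2 G
  interior_or_boundary : ∀ p ∈ G.verts, p ∈ interior G ∨ p ∈ boundary G
  boundary_one_dim : HasDim 1 (G.induce (boundary G))
  edge_of_dist_one : ∀ p ∈ G.verts, ∀ q ∈ G.verts, triLattice.Adj p q → G.Adj p q
  interior_link : ∀ p ∈ interior G, ∀ q ∈ interior G, p ≠ q →
    (∃ b ∈ boundary G, G.Adj b p ∧ G.Adj b q) →
    G.Adj p q ∨ ∃ r ∈ interior G, G.Adj p r ∧ G.Adj q r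

/-- The complement of a domain `G` as a closed region: the subgraph of the lattice induced on all
points that are not interior points of `G`, so that `G` and its complement share the boundary. -/
def complement (G : triLattice.Subgraph) : triLattice.Subgraph :=
  (⊤ : triLattice.Subgraph).induce (interior G)ᶜ

/-- A smooth domain: a domain whose complement is a domain too. -/
def IsSmoothDomain (G : triLattice.Subgraph) : Prop :=
  IsDomain G ∧ IsDomain (complement G)

/-- A closed curve `x_0, …, x_n = x_0` in the interior of `G`, with `d(x_i, x_{i+1}) = 1`. -/
def IsClosedCurve (G : triLattice.Subgraph) {n : ℕ} (x : Fin (n + 1) → ℤ × ℤ) : Prop :=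
  (∀ i, x i ∈ interior G) ∧ x 0 = x (Fin.last n) ∧
    ∀ i : Fin n, triLattice.Adj (x i.castSucc) (x i.succ)

/-- The closed sequences occurring in deformations: as for closed curves, but consecutive points
may also coincide (otherwise a curve could never shrink to a point). -/
def IsLazyClosedCurve (G : triLattice.Subgraph) {n : ℕ} (x : Fin (n + 1) → ℤ × ℤ) : Prop :=
  (∀ i, x i ∈ interior G) ∧ x 0 = x (Fin.last n) ∧
    ∀ i : Fin n, x i.castSucc = x i.succ ∨ triLattice.Adj (x i.castSucc) (x i.succ)

/-- An elementary deformation step `{x_1, …, x_n} → {y_1, …, y_n}` in the interior of `G`: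
`∑ d(x_i, y_i) = 1`, that is, one point is moved to a neighbouring point. -/
def ElementaryStep (G : triLattice.Subgraph) {n : ℕ} (x y : Fin (n + 1) → ℤ × ℤ) : Prop :=
  IsLazyClosedCurve G x ∧ IsLazyClosedCurve G y ∧
    ∑ i : Fin n, triLattice.edist (x i.succ) (y i.succ) = 1

/-- Simply connected: connected, and every closed curve in the interior of `G` can be deformed
within the interior, by finitely many elementary steps, to a constant curve. -/
def IsSimplyConnected (G : triLattice.Subgraph) : Prop :=
  G.Connected ∧
    ∀ (n : ℕ) (x : Fin (n + 1) → ℤ × ℤ), IsClosedCurve G x →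
      ∃ c : ℤ × ℤ, Relation.ReflTransGen (ElementaryStep G) x (fun _ => c)

/-- The arc length `|S_r(p)|`: the number of edges of the sphere `S_r(p)` in `G`. -/
noncomputable def arcLength (G : triLattice.Subgraph) (p : ℤ × ℤ) (r : ℕ) : ℕ :=
  (sphere G p r).edgeSet.ncard

/-- The curvature `K(p) = 2 |S_1(p)| - |S_2(p)|`. -/
noncomputable def curvature (G : triLattice.Subgraph) (p : ℤ × ℤ) : ℤ :=
  2 * (arcLength G p 1 : ℤ) - (arcLength G p 2 : ℤ)

end TriDomain

/-!
The proof reduces the sum of the curvatures to the Euler characteristic of the interior.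

Smoothness makes the boundary a curve. It says that an edge between two boundary points has one
interior and one outer common neighbour, and that every boundary point has interior and outer
neighbours (`IsSmoothDomain.isFrontier`). Around a boundary point the six neighbours therefore form
the cyclic word: boundary point, `i` interior points, boundary point, `4 - i` outer points, with
`1 ≤ i ≤ 3` (`IsLinkWord.identities`). In particular `|S₁(p)| = i + 1`.

An edge of `S₂(p)` spans a triangle with exactly one neighbour `q` of `p`, and `p + 2 (q - p)` is
one of its ends (`IsDomain.arcLength_two`). Counting these triangles from `q` instead of `p` turns the
sum of `|S₂(p)|` over the boundary into a sum of quantities depending only on links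
(`IsFrontier.sum_second_sphere`), and the sum of the curvatures becomes `∑ (4 - 2 i)` over the
boundary points.

Counting the edges and triangles at interior points (`IsFrontier.sum_inNbrs`,
`IsFrontier.sum_triangles`) shows that `∑ (2 - i)` is six times the Euler characteristic
`V - E + F` of the flag complex spanned by the interior points. That this is `1` follows by linear
algebra from the cohomology of this complex (`euler_characteristic`). The interior is connected
because `G` is (`IsSmoothDomain.interior_preconnected`). Every cocycle is the gradient of a
potential, because its sum along a closed curve is invariant under elementary steps
(`ElementaryStep.curveSum_eq`, `IsSimplyConnected.exists_potential`). Finally, there is no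
cohomology in degree two because the complex is a finite part of the plane (`coboundary₁_surjective`).
-/

namespace TriDomain

/-! ### Directions in the triangular lattice -/

/-- The six unit vectors of the lattice in counterclockwise order; indices are taken modulo `6`. -/
def dir : Fin 6 → ℤ × ℤ := ![(1, 0), (0, 1), (-1, 1), (-1, 0), (0, -1), (1, -1)]

lemma dir_injective : Function.Injective dir := by decide

lemma dir_add_three (j : Fin 6) : dir (j + 3) = -dir j := by revert j; decide

lemma dir_add_dir_add_two (j : Fin 6) : dir j + dir (j + 2) = dir (j + 1) := by revert j; decide

lemma triLattice_adj_iff {p q : ℤ × ℤ} : triLattice.Adj p q ↔ ∃ j, q = p + dir j := by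
  obtain ⟨a, b⟩ := p
  obtain ⟨c, d⟩ := q
  constructor
  · intro h
    change (c - a) ^ 2 + (c - a) * (d - b) + (d - b) ^ 2 = 1 at h
    obtain ⟨x, rfl⟩ : ∃ x, c = a + x := ⟨c - a, by ring⟩
    obtain ⟨y, rfl⟩ : ∃ y, d = b + y := ⟨d - b, by ring⟩
    simp only [add_sub_cancel_left] at h
    have hx1 : x ≤ 1 := by nlinarith [sq_nonneg (x + 2 * y)]
    have hx2 : -1 ≤ x := by nlinarith [sq_nonneg (x + 2 * y)]
    have hy1 : y ≤ 1 := by nlinarith [sq_nonneg (y + 2 * x)]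
    have hy2 : -1 ≤ y := by nlinarith [sq_nonneg (y + 2 * x)]
    have key : ∃ j, (x, y) = dir j := by
      interval_cases x <;> interval_cases y <;> first | (exfalso; omega) | decide
    obtain ⟨j, hj⟩ := key
    exact ⟨j, by rw [← hj]; rfl⟩
  · rintro ⟨j, hj⟩
    have hc : c = a + (dir j).1 := congrArg Prod.fst hj
    have hd : d = b + (dir j).2 := congrArg Prod.snd hj
    change (c - a) ^ 2 + (c - a) * (d - b) + (d - b) ^ 2 = 1
    subst hc hd
    simp only [add_sub_cancel_left]
    clear hj
    revert j; decide

lemma adj_add_dir (p : ℤ × ℤ) (j : Fin 6) : triLattice.Adj p (p + dir j) :=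
  triLattice_adj_iff.2 ⟨j, rfl⟩

lemma adj_add_left_iff {p q r : ℤ × ℤ} : triLattice.Adj (p + q) (p + r) ↔ triLattice.Adj q r := by
  simp only [triLattice_adj_iff, add_assoc, add_right_inj]

/-- The common neighbours of `p` and `p + dir j`. -/
lemma common_neighbor {p r : ℤ × ℤ} {j : Fin 6} (h1 : triLattice.Adj p r)
    (h2 : triLattice.Adj (p + dir j) r) : r = p + dir (j + 1) ∨ r = p + dir (j - 1) := by
  obtain ⟨k, rfl⟩ := triLattice_adj_iff.1 h1
  obtain ⟨l, hl⟩ := triLattice_adj_iff.1 (adj_add_left_iff.1 h2)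
  have : ∀ j k l : Fin 6, dir k = dir j + dir l → k = j + 1 ∨ k = j - 1 := by decide
  rcases this j k l hl with rfl | rfl <;> simp

lemma adj_dir_succ (p : ℤ × ℤ) (j : Fin 6) :
    triLattice.Adj (p + dir j) (p + dir (j + 1)) := by
  rw [adj_add_left_iff, triLattice_adj_iff]
  exact ⟨j + 2, (dir_add_dir_add_two j).symm⟩

lemma adj_dir_pred (p : ℤ × ℤ) (j : Fin 6) :
    triLattice.Adj (p + dir j) (p + dir (j - 1)) := by
  have := adj_dir_succ p (j - 1)
  rw [sub_add_cancel] at this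
  exact this.symm

/-! ### Double counting over finite sets of lattice points -/

/-- The indicator function of a finite set of lattice points. -/
def ind (S : Finset (ℤ × ℤ)) (p : ℤ × ℤ) : ℤ := if p ∈ S then 1 else 0

lemma ind_ne_zero {S : Finset (ℤ × ℤ)} {p : ℤ × ℤ} : ind S p ≠ 0 ↔ p ∈ S := by
  simp [ind]

lemma sum_ind_mul {S T : Finset (ℤ × ℤ)} (h : T ⊆ S) (F : ℤ × ℤ → ℤ) :
    ∑ p ∈ S, ind T p * F p = ∑ p ∈ T, F p := by
  rw [← Finset.sum_subset h (f := fun p => ind T p * F p)]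
  · exact Finset.sum_congr rfl fun p hp => by simp [ind, hp]
  · intro p _ hp
    simp [ind, hp]

/-- Translation invariance of sums, for summands whose supports lie in the range of summation. -/
lemma sum_shift {S : Finset (ℤ × ℤ)} {F F' : ℤ × ℤ → ℤ} (v : ℤ × ℤ) (hF : ∀ p, F' p = F (p + v))
    (h1 : ∀ p, F p ≠ 0 → p ∈ S) (h2 : ∀ p, F' p ≠ 0 → p ∈ S) :
    ∑ p ∈ S, F' p = ∑ p ∈ S, F p := by
  rw [← finsum_eq_sum_of_support_subset F fun p hp => h1 p hp,
    ← finsum_eq_sum_of_support_subset F' fun p hp => h2 p hp,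
    ← finsum_comp_equiv (f := F) (Equiv.addRight v)]
  exact finsum_congr fun p => hF p

/-- Counting edges from their other end. -/
lemma sum_pair_comm {S : Finset (ℤ × ℤ)} {f g : ℤ × ℤ → ℤ} (hf : ∀ p, f p ≠ 0 → p ∈ S)
    (hg : ∀ p, g p ≠ 0 → p ∈ S) :
    ∑ p ∈ S, f p * ∑ j, g (p + dir j) = ∑ p ∈ S, g p * ∑ j, f (p + dir j) := by
  simp only [Finset.mul_sum]
  rw [Finset.sum_comm, Finset.sum_comm (s := S), ← Equiv.sum_comp (Equiv.addRight (3 : Fin 6))]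
  refine Finset.sum_congr rfl fun j _ => ?_
  refine sum_shift (dir (j + 3)) (fun p => ?_)
    (fun p hp => hg p (left_ne_zero_of_mul hp)) (fun p hp => hf p (left_ne_zero_of_mul hp))
  simp [dir_add_three, mul_comm]

/-- Counting triangles from another vertex: the summation is invariant under the cyclic rotation of
the three weights. -/
lemma sum_triangle_rotate {S : Finset (ℤ × ℤ)} {f g : ℤ × ℤ → ℤ} (h : ℤ × ℤ → ℤ)
    (hf : ∀ p, f p ≠ 0 → p ∈ S) (hg : ∀ p, g p ≠ 0 → p ∈ S) :
    ∑ p ∈ S, f p * ∑ j, g (p + dir j) * h (p + dir (j + 1)) =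
      ∑ p ∈ S, g p * ∑ j, h (p + dir j) * f (p + dir (j + 1)) := by
  simp only [Finset.mul_sum]
  rw [Finset.sum_comm, Finset.sum_comm (s := S),
    ← Equiv.sum_comp (Equiv.addRight (2 : Fin 6)) (fun j => ∑ p ∈ S,
      g p * (h (p + dir j) * f (p + dir (j + 1))))]
  refine Finset.sum_congr rfl fun j _ => ?_
  refine sum_shift (dir j) (fun p => ?_)
    (fun p hp => hg p (left_ne_zero_of_mul hp)) (fun p hp => hf p (left_ne_zero_of_mul hp))
  have h1 : p + dir j + dir (j + 2) = p + dir (j + 1) := by rw [add_assoc, dir_add_dir_add_two]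
  have h2 : p + dir j + dir (j + 2 + 1) = p := by
    rw [show j + 2 + 1 = j + 3 by rw [add_assoc]; rfl, dir_add_three]; simp
  simp only [Equiv.coe_addRight]
  rw [h1, h2]
  ring


/-! ### Links of boundary points -/

/-- The combinatorial content of a finite smooth domain: the finite set `I` of interior points and
the finite set `B` of boundary points split the lattice into `I`, `B` and the outside, such that no
interior point touches the outside, every boundary point touches both, and any two adjacent boundary
points have one common neighbour in `I` and the other one outside. -/
structure IsFrontier (I B : Finset (ℤ × ℤ)) : Prop where
  disj : ∀ p ∈ B, p ∉ I
  nbr : ∀ p ∈ I, ∀ j, p + dir j ∈ I ∨ p + dir j ∈ B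
  touch_in : ∀ p ∈ B, ∃ j, p + dir j ∈ I
  touch_out : ∀ p ∈ B, ∃ j, p + dir j ∉ I ∧ p + dir j ∉ B
  edge : ∀ p ∈ B, ∀ j, p + dir j ∈ B →
    (p + dir (j + 1) ∈ I ∧ p + dir (j - 1) ∉ I ∧ p + dir (j - 1) ∉ B) ∨
    (p + dir (j - 1) ∈ I ∧ p + dir (j + 1) ∉ I ∧ p + dir (j + 1) ∉ B)

/-- The number of interior neighbours of a lattice point. -/
def inNbrs (I : Finset (ℤ × ℤ)) (p : ℤ × ℤ) : ℤ := ∑ j, ind I (p + dir j)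

/-- The cyclic word of the types of the six neighbours of a boundary point, where `0` stands for
interior points, `1` for boundary points and `2` for points outside. -/
def IsLinkWord (w : Fin 6 → Fin 3) : Prop :=
  (∀ j, w j = 1 → (w (j + 1) = 0 ∧ w (j - 1) = 2) ∨ (w (j - 1) = 0 ∧ w (j + 1) = 2)) ∧
  (∀ j, w j = 0 → w (j + 1) ≠ 2 ∧ w (j - 1) ≠ 2) ∧ (∃ j, w j = 0) ∧ ∃ j, w j = 2

instance (w : Fin 6 → Fin 3) : Decidable (IsLinkWord w) := by
  unfold IsLinkWord; infer_instance

/-- The number of interior letters of a link word. -/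
def inCount (w : Fin 6 → Fin 3) : ℤ := ∑ j, if w j = 0 then 1 else 0

/-- Up to rotation a link word consists of a boundary letter, an arc of one, two or three interior
letters, a second boundary letter and an arc of outer letters. Hence the number of interior letters
determines the number of adjacent pairs of letters of various types. The last sum counts the pairs
of a boundary letter and an edge of non-outer letters one end of which is opposite to it. -/
lemma IsLinkWord.identities : ∀ a b c d e f : Fin 3, IsLinkWord ![a, b, c, d, e, f] →
    let w : Fin 6 → Fin 3 := ![a, b, c, d, e, f]
    (∑ j, (if w j ≠ 2 ∧ w (j + 1) ≠ 2 then 1 else 0 : ℤ)) = inCount w + 1 ∧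
    (∑ j, (if w j = 0 ∧ w (j + 1) = 0 then 1 else 0 : ℤ)) = inCount w - 1 ∧
    (∑ j, (if w j = 0 ∧ w (j + 1) = 1 then 1 else 0 : ℤ)) = 1 ∧
    (∑ j, (if w (j + 3) = 1 ∧ w j ≠ 2 then
      (if w (j + 1) ≠ 2 then 1 else 0) + (if w (j - 1) ≠ 2 then 1 else 0) else 0 : ℤ)) =
        2 * (inCount w - 1) := by
  decide +kernel

/-- The word of types of the neighbours of `p`, see `IsLinkWord`. -/
def linkWord (I B : Finset (ℤ × ℤ)) (p : ℤ × ℤ) (j : Fin 6) : Fin 3 :=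
  if p + dir j ∈ I then 0 else if p + dir j ∈ B then 1 else 2

namespace IsFrontier

variable {I B : Finset (ℤ × ℤ)} {p : ℤ × ℤ}

lemma add_dir_succ_mem (h : IsFrontier I B) {j : Fin 6} (hj : p + dir j ∈ I) :
    p + dir (j + 1) ∈ I ∨ p + dir (j + 1) ∈ B := by
  have := h.nbr _ hj (j + 2)
  rwa [add_assoc, dir_add_dir_add_two] at this

lemma add_dir_pred_mem (h : IsFrontier I B) {j : Fin 6} (hj : p + dir j ∈ I) :
    p + dir (j - 1) ∈ I ∨ p + dir (j - 1) ∈ B := by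
  have h1 := h.nbr _ hj (j + 4)
  have h2 : ∀ j : Fin 6, dir j + dir (j + 4) = dir (j - 1) := by decide
  rwa [add_assoc, h2] at h1

lemma linkWord_eq_zero : ∀ {j}, linkWord I B p j = 0 ↔ p + dir j ∈ I := by
  intro j; unfold linkWord; split_ifs <;> simp_all

lemma linkWord_eq_one (h : IsFrontier I B) {j} : linkWord I B p j = 1 ↔ p + dir j ∈ B := by
  have := h.disj (p + dir j)
  unfold linkWord; split_ifs <;> simp_all

lemma linkWord_eq_two : ∀ {j}, linkWord I B p j = 2 ↔ p + dir j ∉ I ∧ p + dir j ∉ B := by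
  intro j; unfold linkWord; split_ifs <;> simp_all

lemma isLinkWord (h : IsFrontier I B) (hp : p ∈ B) : IsLinkWord (linkWord I B p) := by
  refine ⟨fun j hj => ?_, fun j hj => ?_, ?_, ?_⟩
  · simp only [linkWord_eq_zero, linkWord_eq_two]
    exact h.edge p hp j (h.linkWord_eq_one.1 hj)
  · have h1 := h.add_dir_succ_mem (linkWord_eq_zero.1 hj)
    have h2 := h.add_dir_pred_mem (linkWord_eq_zero.1 hj)
    simp only [ne_eq, linkWord_eq_two]
    tauto
  · simpa only [linkWord_eq_zero] using h.touch_in p hp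
  · simpa only [linkWord_eq_two] using h.touch_out p hp

lemma ind_inner : ∀ j, ind I (p + dir j) = if linkWord I B p j = 0 then 1 else 0 := by
  intro j; simp only [linkWord_eq_zero, ind]

lemma ind_boundary (h : IsFrontier I B) (j) :
    ind B (p + dir j) = if linkWord I B p j = 1 then 1 else 0 := by
  simp only [h.linkWord_eq_one, ind]

lemma ind_union (j) : ind (I ∪ B) (p + dir j) = if linkWord I B p j ≠ 2 then 1 else 0 := by
  simp only [ind, Finset.mem_union, ne_eq, linkWord_eq_two]
  congr 1
  rw [eq_iff_iff]; tauto

lemma link_identities (h : IsFrontier I B) (hp : p ∈ B) :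
    (∑ j, ind (I ∪ B) (p + dir j) * ind (I ∪ B) (p + dir (j + 1))) = inNbrs I p + 1 ∧
    (∑ j, ind I (p + dir j) * ind I (p + dir (j + 1))) = inNbrs I p - 1 ∧
    (∑ j, ind I (p + dir j) * ind B (p + dir (j + 1))) = 1 ∧
    (∑ j, ind B (p + dir (j + 3)) * (ind (I ∪ B) (p + dir j) *
      (ind (I ∪ B) (p + dir (j + 1)) + ind (I ∪ B) (p + dir (j - 1))))) =
        2 * (inNbrs I p - 1) := by
  have hw := h.isLinkWord hp
  have hn : inNbrs I p = inCount (linkWord I B p) := by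
    simp only [inNbrs, inCount, ind_inner (I := I) (B := B)]
  simp only [hn, ind_inner (I := I) (B := B), h.ind_boundary, ind_union]
  generalize linkWord I B p = w at *
  have hv : w = ![w 0, w 1, w 2, w 3, w 4, w 5] := by
    funext j; fin_cases j <;> rfl
  rw [hv] at hw ⊢
  obtain ⟨h1, h2, h3, h4⟩ := IsLinkWord.identities _ _ _ _ _ _ hw
  refine ⟨?_, ?_, ?_, ?_⟩
  · rw [← h1]
    exact Finset.sum_congr rfl fun j _ => by rw [ite_zero_mul_ite_zero, mul_one]
  · rw [← h2]
    exact Finset.sum_congr rfl fun j _ => by rw [ite_zero_mul_ite_zero, mul_one]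
  · refine Eq.trans ?_ h3
    exact Finset.sum_congr rfl fun j _ => by rw [ite_zero_mul_ite_zero, mul_one]
  · rw [← h4]
    refine Finset.sum_congr rfl fun j _ => ?_
    rw [← mul_assoc, ite_zero_mul_ite_zero, mul_one, ite_mul, one_mul, zero_mul]

lemma ind_union_eq (h : IsFrontier I B) (q : ℤ × ℤ) : ind (I ∪ B) q = ind I q + ind B q := by
  have := h.disj q
  unfold ind
  split_ifs <;> simp_all

lemma ind_union_add_dir (h : IsFrontier I B) (hp : p ∈ I) (j) : ind (I ∪ B) (p + dir j) = 1 := by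
  exact if_pos (Finset.mem_union.2 (h.nbr p hp j))

lemma mem_union_of_ind_left {q : ℤ × ℤ} (hq : ind I q ≠ 0) : q ∈ I ∪ B :=
  Finset.mem_union_left _ (ind_ne_zero.1 hq)

lemma mem_union_of_ind_right {q : ℤ × ℤ} (hq : ind B q ≠ 0) : q ∈ I ∪ B :=
  Finset.mem_union_right _ (ind_ne_zero.1 hq)

/-! ### Sums over the boundary -/

/-- Pairs of an interior point and a neighbouring boundary point, counted in both ways. -/
lemma sum_boundary_nbrs (I B : Finset (ℤ × ℤ)) :
    ∑ p ∈ I, ∑ j, ind B (p + dir j) = ∑ p ∈ B, inNbrs I p := by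
  rw [← sum_ind_mul (Finset.subset_union_left (s₂ := B)),
    sum_pair_comm (fun p => mem_union_of_ind_left) (fun p => mem_union_of_ind_right),
    sum_ind_mul Finset.subset_union_right]
  rfl

/-- Twice the number of interior edges. -/
lemma sum_inNbrs (h : IsFrontier I B) :
    ∑ p ∈ I, inNbrs I p = 6 * (I.card : ℤ) - ∑ p ∈ B, inNbrs I p := by
  rw [← sum_boundary_nbrs I B, eq_sub_iff_add_eq, ← Finset.sum_add_distrib]
  have : ∀ p ∈ I, inNbrs I p + ∑ j, ind B (p + dir j) = 6 := fun p hp => by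
    simp only [inNbrs, ← Finset.sum_add_distrib, ← h.ind_union_eq, h.ind_union_add_dir hp]
    simp
  rw [Finset.sum_congr rfl this]
  simp [mul_comm]

/-- Three times the number of interior triangles. -/
lemma sum_triangles (h : IsFrontier I B) :
    ∑ p ∈ I, ∑ j, ind I (p + dir j) * ind I (p + dir (j + 1)) =
      6 * (I.card : ℤ) - 2 * ∑ p ∈ B, inNbrs I p + (B.card : ℤ) := by
  have hI := fun p => mem_union_of_ind_left (I := I) (B := B) (q := p)
  have hB := fun p => mem_union_of_ind_right (I := I) (B := B) (q := p)
  have e1 : ∑ p ∈ I, ∑ j, ind B (p + dir j) * ind I (p + dir (j + 1)) =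
      ∑ p ∈ B, (inNbrs I p - 1) := by
    rw [← sum_ind_mul (Finset.subset_union_left (s₂ := B)), sum_triangle_rotate _ hI hB,
      sum_ind_mul Finset.subset_union_right]
    exact Finset.sum_congr rfl fun p hp => (h.link_identities hp).2.1
  have e2 : ∑ p ∈ I, ∑ j, ind I (p + dir j) * ind B (p + dir (j + 1)) =
      ∑ p ∈ B, (inNbrs I p - 1) := by
    rw [← sum_ind_mul (Finset.subset_union_left (s₂ := B)), ← sum_triangle_rotate _ hB hI,
      sum_ind_mul Finset.subset_union_right]
    exact Finset.sum_congr rfl fun p hp => (h.link_identities hp).2.1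
  have e3 : ∑ p ∈ I, ∑ j, ind B (p + dir j) * ind B (p + dir (j + 1)) = ∑ p ∈ B, 1 := by
    rw [← sum_ind_mul (Finset.subset_union_left (s₂ := B)), ← sum_triangle_rotate _ hB hI,
      sum_ind_mul Finset.subset_union_right]
    exact Finset.sum_congr rfl fun p hp => (h.link_identities hp).2.2.1
  have tot : ∀ p ∈ I, ∑ j, ind I (p + dir j) * ind I (p + dir (j + 1)) =
      6 - ∑ j, ind B (p + dir j) * ind I (p + dir (j + 1)) -
      ∑ j, ind I (p + dir j) * ind B (p + dir (j + 1)) -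
      ∑ j, ind B (p + dir j) * ind B (p + dir (j + 1)) := fun p hp => by
    have hb : ∀ j, ind B (p + dir j) = 1 - ind I (p + dir j) := fun j => by
      have := h.ind_union_add_dir hp j
      rw [h.ind_union_eq] at this
      linarith
    simp only [hb, Fin.sum_univ_six]
    ring
  rw [Finset.sum_congr rfl tot]
  simp only [Finset.sum_sub_distrib, e1, e2, e3]
  simp
  ring

/-- The total length of the spheres of radius two around boundary points. An edge of `S₂(p)` has one
end of the form `p + 2 • dir j`, and it forms a triangle with the neighbour `q = p + dir j` of `p`.
Grouped by `q` instead of `p`, the count depends only on the link of `q`: the opposite end of every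
boundary neighbour of an interior point `q` contributes two edges, and for boundary points `q` the
count is the last of the identities for link words. -/
lemma sum_second_sphere (h : IsFrontier I B) :
    ∑ p ∈ B, ∑ j, ind (I ∪ B) (p + dir j) * (ind (I ∪ B) (p + dir j + dir j) *
      (ind (I ∪ B) (p + dir j + dir (j + 1)) + ind (I ∪ B) (p + dir j + dir (j - 1)))) =
      4 * ∑ p ∈ B, inNbrs I p - 2 * (B.card : ℤ) := by
  set c : ℤ × ℤ → Fin 6 → ℤ := fun q j => ind (I ∪ B) (q + dir j) *
    (ind (I ∪ B) (q + dir (j + 1)) + ind (I ∪ B) (q + dir (j - 1))) with hc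
  have e1 : ∑ p ∈ B, ∑ j, ind (I ∪ B) (p + dir j) * c (p + dir j) j =
      ∑ q ∈ I ∪ B, ∑ j, ind B (q + dir (j + 3)) * c q j := by
    rw [← sum_ind_mul (Finset.subset_union_right (s₁ := I))]
    simp only [Finset.mul_sum]
    rw [Finset.sum_comm, Finset.sum_comm (s := I ∪ B)]
    refine Finset.sum_congr rfl fun j _ => ?_
    rw [← sum_ind_mul (Finset.Subset.refl (I ∪ B)) fun q => ind B (q + dir (j + 3)) * c q j]
    refine sum_shift (dir j) (fun p => ?_)
      (fun p hp => ind_ne_zero.1 (left_ne_zero_of_mul hp))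
      (fun p hp => mem_union_of_ind_right (left_ne_zero_of_mul hp))
    rw [dir_add_three, add_neg_cancel_right]
    ring
  have e2 : ∀ q ∈ I, ∑ j, ind B (q + dir (j + 3)) * c q j = 2 * ∑ j, ind B (q + dir j) := by
    intro q hq
    simp only [hc, h.ind_union_add_dir hq, ← Finset.sum_mul]
    rw [← Equiv.sum_comp (Equiv.addRight (3 : Fin 6)) fun j => ind B (q + dir j)]
    simp only [Equiv.coe_addRight]
    ring
  rw [e1, Finset.sum_union (Finset.disjoint_right.2 h.disj), Finset.sum_congr rfl e2,
    ← Finset.mul_sum, sum_boundary_nbrs I B,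
    Finset.sum_congr rfl fun q hq => (h.link_identities hq).2.2.2, ← Finset.mul_sum]
  simp
  ring

end IsFrontier

/-! ### The Euler characteristic of the interior -/

/-- Extension by zero of a rational function on a finite set. -/
def extendZero {α : Type*} [DecidableEq α] (S : Finset α) : (S → ℚ) →ₗ[ℚ] (α → ℚ) where
  toFun f a := if h : a ∈ S then f ⟨a, h⟩ else 0
  map_add' f g := by ext a; by_cases h : a ∈ S <;> simp [h]
  map_smul' c f := by ext a; by_cases h : a ∈ S <;> simp [h]

lemma extendZero_of_mem {α : Type*} [DecidableEq α] {S : Finset α} (f : S → ℚ) {a : α}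
    (h : a ∈ S) : extendZero S f a = f ⟨a, h⟩ := dif_pos h

/-- The edges of the graph induced on `I`; the pair `(p, j)` stands for the edge from `p` to
`p + dir j`. The three directions `0`, `1`, `2` reach each edge exactly once. -/
def edges (I : Finset (ℤ × ℤ)) : Finset ((ℤ × ℤ) × Fin 6) :=
  (I ×ˢ {0, 1, 2}).filter fun e => e.1 + dir e.2 ∈ I

/-- The triangles of the graph induced on `I`; the pair `(p, j)` stands for the triangle with
vertices `p`, `p + dir j`, `p + dir (j + 1)`. The values `0` and `1` of `j` give the two
orientations of triangles, and `p` is the lowest vertex (the lower left one if two are lowest). -/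
def triangles (I : Finset (ℤ × ℤ)) : Finset ((ℤ × ℤ) × Fin 6) :=
  (I ×ˢ {0, 1}).filter fun t => t.1 + dir t.2 ∈ I ∧ t.1 + dir (t.2 + 1) ∈ I

variable {I : Finset (ℤ × ℤ)}

lemma mem_edges {p : ℤ × ℤ} {j : Fin 6} :
    (p, j) ∈ edges I ↔ p ∈ I ∧ p + dir j ∈ I ∧ (j = 0 ∨ j = 1 ∨ j = 2) := by
  simp [edges]; tauto

lemma mem_triangles {p : ℤ × ℤ} {j : Fin 6} :
    (p, j) ∈ triangles I ↔ p ∈ I ∧ p + dir j ∈ I ∧ p + dir (j + 1) ∈ I ∧ (j = 0 ∨ j = 1) := by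
  simp [triangles]; tauto

lemma dir_zero_add_dir_two (p : ℤ × ℤ) : p + dir 0 + dir 2 = p + dir 1 := by
  rw [add_assoc]; rfl

lemma dir_two_add_dir_zero (p : ℤ × ℤ) : p + dir 2 + dir 0 = p + dir 1 := by
  rw [add_assoc]; rfl

/-- The coboundary from vertex functions to edge functions. -/
def coboundary₀ (I : Finset (ℤ × ℤ)) : (I → ℚ) →ₗ[ℚ] (edges I → ℚ) where
  toFun f e := extendZero I f (e.1.1 + dir e.1.2) - extendZero I f e.1.1
  map_add' f g := by ext e; simp; ring
  map_smul' c f := by ext e; simp; ring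

/-- The sum of an edge function along the boundary of a triangle. -/
def circulation (F : (ℤ × ℤ) × Fin 6 → ℚ) (t : (ℤ × ℤ) × Fin 6) : ℚ :=
  if t.2 = 0 then F (t.1, 0) + F (t.1 + dir 0, 2) - F (t.1, 1)
  else F (t.1, 1) - F (t.1 + dir 2, 0) - F (t.1, 2)

/-- The coboundary from edge functions to triangle functions. -/
def coboundary₁ (I : Finset (ℤ × ℤ)) : (edges I → ℚ) →ₗ[ℚ] (triangles I → ℚ) where
  toFun f t := circulation (extendZero (edges I) f) t
  map_add' f g := by ext t; simp only [circulation, map_add, Pi.add_apply]; split_ifs <;> ring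
  map_smul' c f := by
    ext t; simp only [circulation, map_smul, Pi.smul_apply, smul_eq_mul, RingHom.id_apply]
    split_ifs <;> ring

lemma circulation_congr {F F' : (ℤ × ℤ) × Fin 6 → ℚ} (h : ∀ e ∈ edges I, F e = F' e)
    {t : (ℤ × ℤ) × Fin 6} (ht : t ∈ triangles I) : circulation F t = circulation F' t := by
  obtain ⟨p, j⟩ := t
  obtain ⟨h0, h1, h2, rfl | rfl⟩ := mem_triangles.1 ht
  · have h2' : p + dir 1 ∈ I := h2
    simp only [circulation, if_true]
    rw [h (p, 0) (mem_edges.2 ⟨h0, h1, by simp⟩), h (p, 1) (mem_edges.2 ⟨h0, h2', by simp⟩),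
      h (p + dir 0, 2) (mem_edges.2 ⟨h1, by rwa [dir_zero_add_dir_two], by simp⟩)]
  · have h2' : p + dir 2 ∈ I := h2
    simp only [circulation, one_ne_zero, if_false]
    rw [h (p, 1) (mem_edges.2 ⟨h0, h1, by simp⟩), h (p, 2) (mem_edges.2 ⟨h0, h2', by simp⟩),
      h (p + dir 2, 0) (mem_edges.2 ⟨h2', by rwa [dir_two_add_dir_zero], by simp⟩)]

/-- The two coboundaries compose to zero. -/
lemma coboundary₀_mem_ker (φ : I → ℚ) : coboundary₀ I φ ∈ LinearMap.ker (coboundary₁ I) := by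
  rw [LinearMap.mem_ker]
  ext t
  change circulation (extendZero (edges I) (coboundary₀ I φ)) t = 0
  rw [circulation_congr (F' := fun e => extendZero I φ (e.1 + dir e.2) - extendZero I φ e.1)
    (fun e he => extendZero_of_mem _ he) t.2]
  simp only [circulation, dir_zero_add_dir_two, dir_two_add_dir_zero]
  split_ifs <;> ring

/-- Every function on triangles is a coboundary: there is no second cohomology, because the strips
of triangles between neighbouring lattice lines are unbounded and the values can be matched one
after the other along each strip. -/
lemma coboundary₁_surjective (I : Finset (ℤ × ℤ)) : Function.Surjective (coboundary₁ I) := by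
  intro t
  obtain ⟨N, hN⟩ := (I.image Prod.snd).bddBelow
  have hN : ∀ p ∈ I, N ≤ p.2 := fun p hp => hN (by simpa using ⟨p.1, hp⟩)
  set τ := extendZero (triangles I) t with hτ
  -- Edges in direction `2` get the value `0`, so the other edges of a strip form a sequence along
  -- which the differences are prescribed.
  set a : ℤ × ℤ → ℚ := fun p => ∑ b ∈ Finset.Ico N p.2,
    -(τ ((p.1 + p.2 - b, b), 1) + τ ((p.1 + p.2 - b, b), 0)) with ha
  set F : (ℤ × ℤ) × Fin 6 → ℚ := fun e =>
    if e.2 = 0 then a e.1 else if e.2 = 1 then a e.1 - τ (e.1, 0) else 0 with hF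
  have step : ∀ p : ℤ × ℤ, N ≤ p.2 → a (p + dir 2) = a p - (τ (p, 1) + τ (p, 0)) := by
    rintro ⟨x, y⟩ (hp : N ≤ y)
    have e1 : (x, y) + dir 2 = (x - 1, y + 1) := by simp [dir, sub_eq_add_neg]
    simp only [ha, e1]
    rw [show Finset.Ico N (y + 1) = insert y (Finset.Ico N y) by ext; simp; omega,
      Finset.sum_insert (by simp)]
    have e2 : x - 1 + (y + 1) = x + y := by ring
    simp only [e2, add_sub_cancel_right]
    ring
  refine ⟨fun e => F e, ?_⟩
  ext ⟨⟨p, j⟩, ht⟩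
  change circulation (extendZero (edges I) fun e => F e) (p, j) = _
  rw [circulation_congr (F' := F) (fun e he => extendZero_of_mem _ he) ht,
    ← extendZero_of_mem t ht, ← hτ]
  obtain ⟨h0, h1, h2, rfl | rfl⟩ := mem_triangles.1 ht
  · simp [circulation, hF]
  · simp only [circulation, hF]
    simp only [one_ne_zero, if_false, if_true, step p (hN p h0), show (2 : Fin 6) ≠ 0 by decide,
      show (2 : Fin 6) ≠ 1 by decide]
    ring

/-- A function on pairs of points of `S` which is additive along degenerate and nondegenerate
triangles: a simplicial `1`-cocycle. -/
def IsCocycle (S : Set (ℤ × ℤ)) (ω : ℤ × ℤ → ℤ × ℤ → ℚ) : Prop :=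
  ∀ a ∈ S, ∀ b ∈ S, ∀ c ∈ S, (a = b ∨ triLattice.Adj a b) → (b = c ∨ triLattice.Adj b c) →
    (a = c ∨ triLattice.Adj a c) → ω a b + ω b c = ω a c

/-- The antisymmetric function on pairs of points belonging to an edge function. -/
def pairing (F : (ℤ × ℤ) × Fin 6 → ℚ) (a b : ℤ × ℤ) : ℚ :=
  ∑ j ∈ ({0, 1, 2} : Finset (Fin 6)),
    ((if b = a + dir j then F (a, j) else 0) - (if a = b + dir j then F (b, j) else 0))

lemma pairing_swap (F : (ℤ × ℤ) × Fin 6 → ℚ) (a b : ℤ × ℤ) : pairing F b a = -pairing F a b := by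
  simp only [pairing, ← Finset.sum_neg_distrib, neg_sub]

lemma pairing_add_dir (F : (ℤ × ℤ) × Fin 6 → ℚ) (a : ℤ × ℤ) {j : Fin 6}
    (hj : j = 0 ∨ j = 1 ∨ j = 2) : pairing F a (a + dir j) = F (a, j) := by
  have h1 : ∀ i, a + dir j = a + dir i ↔ j = i := fun i => by
    rw [add_right_inj, dir_injective.eq_iff]
  have h2 : ∀ i ∈ ({0, 1, 2} : Finset (Fin 6)), a ≠ a + dir j + dir i := fun i hi h => by
    rw [add_assoc, left_eq_add] at h
    have : ∀ j ∈ ({0, 1, 2} : Finset (Fin 6)), ∀ i ∈ ({0, 1, 2} : Finset (Fin 6)),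
      dir j + dir i ≠ 0 := by decide
    exact this j (by simpa using hj) i hi h
  rw [pairing, Finset.sum_congr rfl fun i hi => by rw [if_neg (h2 i hi), sub_zero]]
  simp only [h1]
  rw [Finset.sum_ite_eq, if_pos (by simpa using hj)]

/-- An edge function with vanishing coboundary defines a cocycle on pairs of points. -/
lemma isCocycle_pairing {F : (ℤ × ℤ) × Fin 6 → ℚ}
    (h : ∀ t ∈ triangles I, circulation F t = 0) : IsCocycle I (pairing F) := by
  have hself : ∀ a, pairing F a a = 0 := fun a => by linarith [pairing_swap F a a]
  have hdir : ∀ a j, a ∈ I → a + dir j ∈ I → a + dir (j + 1) ∈ I →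
      pairing F a (a + dir j) + pairing F (a + dir j) (a + dir (j + 1)) +
        pairing F (a + dir (j + 1)) a = 0 := by
    have up : ∀ p, p ∈ I → p + dir 0 ∈ I → p + dir 1 ∈ I → pairing F p (p + dir 0) +
        pairing F (p + dir 0) (p + dir 1) + pairing F (p + dir 1) p = 0 := fun p h0 h1 h2 => by
      have := h (p, 0) (mem_triangles.2 ⟨h0, h1, h2, by simp⟩)
      simp only [circulation, if_true] at this
      rw [pairing_swap F p (p + dir 1), ← dir_zero_add_dir_two, pairing_add_dir F _ (by simp),
        pairing_add_dir F _ (by simp), dir_zero_add_dir_two, pairing_add_dir F _ (by simp)]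
      linarith
    have down : ∀ p, p ∈ I → p + dir 1 ∈ I → p + dir 2 ∈ I → pairing F p (p + dir 1) +
        pairing F (p + dir 1) (p + dir 2) + pairing F (p + dir 2) p = 0 := fun p h0 h1 h2 => by
      have := h (p, 1) (mem_triangles.2 ⟨h0, h1, h2, by simp⟩)
      simp only [circulation, one_ne_zero, if_false] at this
      rw [pairing_swap F p (p + dir 2), pairing_swap F (p + dir 2) (p + dir 1),
        ← dir_two_add_dir_zero, pairing_add_dir F _ (by simp),
        pairing_add_dir F _ (by simp), dir_two_add_dir_zero, pairing_add_dir F _ (by simp)]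
      linarith
    -- The six triangles around `a` are seen from their base points.
    intro a j
    have sh : ∀ i k l, dir i + dir k = dir l → a + dir i + dir k = a + dir l := fun i k l e => by
      rw [add_assoc, e]
    have s0 : ∀ i k, dir i + dir k = 0 → a + dir i + dir k = a := fun i k e => by
      rw [add_assoc, e, add_zero]
    intro h0 h1 h2
    fin_cases j
    · exact up a h0 h1 h2
    · exact down a h0 h1 h2
    · have := up (a + dir 3)
      rw [s0 3 0 (by decide), sh 3 1 2 (by decide)] at this
      exact (add_rotate _ _ _).symm.trans (this h2 h0 h1)
    · have := down (a + dir 4)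
      rw [s0 4 1 (by decide), sh 4 2 3 (by decide)] at this
      exact (add_rotate _ _ _).symm.trans (this h2 h0 h1)
    · have := up (a + dir 4)
      rw [s0 4 1 (by decide), sh 4 0 5 (by decide)] at this
      exact (add_rotate _ _ _).trans (this h1 h2 h0)
    · have := down (a + dir 5)
      rw [s0 5 2 (by decide), sh 5 1 0 (by decide)] at this
      exact (add_rotate _ _ _).trans (this h1 h2 h0)
  intro a ha b hb c hc hab hbc hac
  rcases hab with rfl | hab
  · rw [hself, zero_add]
  rcases hbc with rfl | hbc
  · rw [hself, add_zero]
  rcases hac with rfl | hac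
  · rw [hself, pairing_swap F a b]; ring
  obtain ⟨j, rfl⟩ := triLattice_adj_iff.1 hab
  rcases common_neighbor hac hbc with rfl | rfl
  · have := hdir a j ha hb hc
    rw [pairing_swap F a] at this
    linarith
  · have := hdir a (j - 1) ha hc (by rwa [sub_add_cancel])
    rw [sub_add_cancel, pairing_swap F a (a + dir j),
      pairing_swap F (a + dir j) (a + dir (j - 1))] at this
    linarith

/-- If the flag complex of the graph induced on `I` has the connectivity and the first cohomology of
a point, its Euler characteristic is `1`. -/
theorem euler_characteristic (hne : I.Nonempty)
    (hconn : ∀ φ : ℤ × ℤ → ℚ, (∀ a ∈ I, ∀ b ∈ I, triLattice.Adj a b → φ a = φ b) →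
      ∀ a ∈ I, ∀ b ∈ I, φ a = φ b)
    (hexact : ∀ ω, IsCocycle I ω → ∃ φ : ℤ × ℤ → ℚ,
      ∀ a ∈ I, ∀ b ∈ I, triLattice.Adj a b → ω a b = φ b - φ a) :
    I.card + (triangles I).card = (edges I).card + 1 := by
  obtain ⟨v, hv⟩ := hne
  -- The cochain complex is exact except for the constants at its start, so the claim is the
  -- alternating sum of the dimensions of its terms.
  have hker0 : LinearMap.ker (coboundary₀ I) = Submodule.span ℚ {fun _ => 1} := by
    ext φ
    rw [LinearMap.mem_ker, Submodule.mem_span_singleton]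
    constructor
    · intro h
      have hd : ∀ p j, (p, j) ∈ edges I → extendZero I φ p = extendZero I φ (p + dir j) :=
        fun p j hp => by
          have := congrFun h ⟨(p, j), hp⟩
          change extendZero I φ (p + dir j) - extendZero I φ p = 0 at this
          linarith
      have hd' : ∀ a ∈ I, ∀ b ∈ I, triLattice.Adj a b → extendZero I φ a = extendZero I φ b := by
        intro a ha b hb hab
        obtain ⟨j, rfl⟩ := triLattice_adj_iff.1 hab
        have : ∀ j : Fin 6, (j = 0 ∨ j = 1 ∨ j = 2) ∨ (j + 3 = 0 ∨ j + 3 = 1 ∨ j + 3 = 2) := by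
          decide
        rcases this j with hj | hj
        · exact hd _ _ (mem_edges.2 ⟨ha, hb, hj⟩)
        · have e : a + dir j + dir (j + 3) = a := by rw [dir_add_three]; simp
          have := hd _ _ (mem_edges.2 ⟨hb, by rwa [e], hj⟩)
          rw [e] at this
          exact this.symm
      refine ⟨φ ⟨v, hv⟩, ?_⟩
      ext ⟨p, hp⟩
      have := hconn _ hd' p hp v hv
      rw [extendZero_of_mem _ hp, extendZero_of_mem _ hv] at this
      simp [this]
    · rintro ⟨c, rfl⟩
      ext ⟨⟨p, j⟩, hp⟩
      change extendZero I _ (p + dir j) - extendZero I _ p = 0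
      obtain ⟨h1, h2, -⟩ := mem_edges.1 hp
      rw [extendZero_of_mem _ h1, extendZero_of_mem _ h2]
      simp
  have hker1 : LinearMap.ker (coboundary₁ I) = LinearMap.range (coboundary₀ I) := by
    refine le_antisymm (fun f hf => ?_) ?_
    · obtain ⟨φ, hφ⟩ := hexact _ (isCocycle_pairing (F := extendZero (edges I) f)
        fun t ht => congrFun (LinearMap.mem_ker.1 hf) ⟨t, ht⟩)
      refine ⟨fun p => φ p, ?_⟩
      ext ⟨⟨p, j⟩, hp⟩
      obtain ⟨h1, h2, h3⟩ := mem_edges.1 hp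
      change extendZero I _ (p + dir j) - extendZero I _ p = _
      rw [extendZero_of_mem _ h1, extendZero_of_mem _ h2, ← hφ p h1 _ h2 (adj_add_dir p j),
        pairing_add_dir _ _ h3, extendZero_of_mem _ hp]
    · rintro _ ⟨φ, rfl⟩
      exact coboundary₀_mem_ker φ
  have r0 := (coboundary₀ I).finrank_range_add_finrank_ker
  have r1 := (coboundary₁ I).finrank_range_add_finrank_ker
  rw [hker0, finrank_span_singleton fun h => one_ne_zero (congrFun h ⟨v, hv⟩),
    Module.finrank_fintype_fun_eq_card, Fintype.card_coe] at r0
  rw [hker1, LinearMap.range_eq_top.2 (coboundary₁_surjective I), finrank_top,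
    Module.finrank_fintype_fun_eq_card, Module.finrank_fintype_fun_eq_card,
    Fintype.card_coe, Fintype.card_coe] at r1
  omega

/-! ### Counting edges and triangles -/

lemma two_mul_card_edges (I : Finset (ℤ × ℤ)) :
    2 * ((edges I).card : ℤ) = ∑ p ∈ I, inNbrs I p := by
  have h0 : ∀ p, ind I p ≠ 0 → p ∈ I := fun p => ind_ne_zero.1
  have e : ((edges I).card : ℤ) =
      ∑ p ∈ I, (ind I (p + dir 0) + ind I (p + dir 1) + ind I (p + dir 2)) := by
    rw [edges, Finset.card_filter, Nat.cast_sum, Finset.sum_product]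
    refine Finset.sum_congr rfl fun p _ => ?_
    rw [Finset.sum_insert (by decide), Finset.sum_insert (by decide), Finset.sum_singleton]
    simp [ind, add_assoc]
  have hs : ∀ j, ∑ p ∈ I, ind I (p + dir (j + 3)) = ∑ p ∈ I, ind I (p + dir j) := fun j => by
    rw [← sum_ind_mul (Finset.Subset.refl I),
      ← sum_ind_mul (Finset.Subset.refl I) fun p => ind I (p + dir j)]
    refine sum_shift (dir (j + 3)) (fun p => ?_) (fun p hp => h0 p (left_ne_zero_of_mul hp))
      (fun p hp => h0 p (left_ne_zero_of_mul hp))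
    simp [dir_add_three, mul_comm]
  have h3 := hs 0
  have h4 := hs 1
  have h5 := hs 2
  simp only [inNbrs, Fin.sum_univ_six, Finset.sum_add_distrib, e] at h3 h4 h5 ⊢
  change ∑ p ∈ I, ind I (p + dir 3) = _ at h3
  change ∑ p ∈ I, ind I (p + dir 4) = _ at h4
  change ∑ p ∈ I, ind I (p + dir 5) = _ at h5
  linarith

lemma three_mul_card_triangles (I : Finset (ℤ × ℤ)) :
    3 * ((triangles I).card : ℤ) =
      ∑ p ∈ I, ∑ j, ind I (p + dir j) * ind I (p + dir (j + 1)) := by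
  have h0 : ∀ p, ind I p ≠ 0 → p ∈ I := fun p => ind_ne_zero.1
  have e : ((triangles I).card : ℤ) = ∑ p ∈ I, (ind I (p + dir 0) * ind I (p + dir 1) +
      ind I (p + dir 1) * ind I (p + dir 2)) := by
    rw [triangles, Finset.card_filter, Nat.cast_sum, Finset.sum_product]
    refine Finset.sum_congr rfl fun p _ => ?_
    rw [Finset.sum_insert (by decide), Finset.sum_singleton]
    simp only [ind, ite_and, Nat.cast_ite, Nat.cast_one, Nat.cast_zero, Fin.reduceAdd]
    split_ifs <;> rfl
  have hs : ∀ j, ∑ p ∈ I, ind I (p + dir (j + 2)) * ind I (p + dir (j + 2 + 1)) =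
      ∑ p ∈ I, ind I (p + dir j) * ind I (p + dir (j + 1)) := fun j => by
    rw [← sum_ind_mul (Finset.Subset.refl I),
      ← sum_ind_mul (Finset.Subset.refl I) fun p => ind I (p + dir j) * ind I (p + dir (j + 1))]
    refine sum_shift (dir (j + 3)) (fun p => ?_) (fun p hp => h0 p (left_ne_zero_of_mul hp))
      (fun p hp => h0 p (left_ne_zero_of_mul hp))
    have e1 : ∀ j, dir (j + 3) + dir j = 0 := by decide
    have e2 : ∀ j, dir (j + 3) + dir (j + 1) = dir (j + 2) := by decide
    have e3 : ∀ j : Fin 6, j + 2 + 1 = j + 3 := by decide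
    simp only [add_assoc p, e1, e2, e3, add_zero]
    ring
  have h2 := hs 0
  have h3 := hs 1
  have h4 := hs 2
  have h5 := hs 3
  simp only [Fin.sum_univ_six, Finset.sum_add_distrib, e]
  simp only [Fin.reduceAdd] at *
  linarith


/-! ### Closed curves and potentials -/

lemma IsCocycle.self {S : Set (ℤ × ℤ)} {ω : ℤ × ℤ → ℤ × ℤ → ℚ} (h : IsCocycle S ω) {a : ℤ × ℤ}
    (ha : a ∈ S) : ω a a = 0 := by
  have := h a ha a ha a ha (.inl rfl) (.inl rfl) (.inl rfl)
  linarith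

lemma IsCocycle.swap {S : Set (ℤ × ℤ)} {ω : ℤ × ℤ → ℤ × ℤ → ℚ} (h : IsCocycle S ω)
    {a b : ℤ × ℤ} (ha : a ∈ S) (hb : b ∈ S) (hab : triLattice.Adj a b) : ω b a = -ω a b := by
  have := h a ha b hb a ha (.inr hab) (.inr hab.symm) (.inl rfl)
  rw [h.self ha] at this
  linarith

/-- The sum of a function on pairs along a sequence of points. -/
def curveSum (ω : ℤ × ℤ → ℤ × ℤ → ℚ) {n : ℕ} (x : Fin (n + 1) → ℤ × ℤ) : ℚ :=
  ∑ i : Fin n, ω (x i.castSucc) (x i.succ)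

variable {G : triLattice.Subgraph}

/-- The sum of a cocycle along a closed curve does not change in an elementary step: the quadrangle
between two consecutive points and their successors is degenerate, hence splits into triangles. -/
lemma ElementaryStep.curveSum_eq {ω : ℤ × ℤ → ℤ × ℤ → ℚ} (hω : IsCocycle (interior G) ω) {n : ℕ}
    {x y : Fin (n + 1) → ℤ × ℤ} (h : ElementaryStep G x y) : curveSum ω x = curveSum ω y := by
  obtain ⟨⟨hxI, hx0, hx⟩, ⟨hyI, hy0, hy⟩, hsum⟩ := h
  have hle : ∀ i : Fin n, x i.succ = y i.succ ∨ triLattice.Adj (x i.succ) (y i.succ) := fun i => by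
    rw [or_comm, ← SimpleGraph.edist_le_one_iff_adj_or_eq, ← hsum]
    exact Finset.single_le_sum (f := fun i : Fin n => triLattice.edist (x i.succ) (y i.succ))
      (fun _ _ => zero_le) (Finset.mem_univ i)
  have huniq : ∀ i j : Fin n, i ≠ j → x i.succ = y i.succ ∨ x j.succ = y j.succ := by
    intro i j hij
    by_contra! hne
    have h1 : ∀ k : Fin n, x k.succ ≠ y k.succ → 1 ≤ triLattice.edist (x k.succ) (y k.succ) :=
      fun k hk => Order.one_le_iff_pos.2 (SimpleGraph.edist_pos_of_ne hk)
    have h2 := Finset.sum_le_sum_of_subset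
      (f := fun i : Fin n => triLattice.edist (x i.succ) (y i.succ)) (Finset.subset_univ {i, j})
    rw [Finset.sum_pair hij, hsum] at h2
    have h3 : (1 + 1 : ℕ∞) ≤ 1 := (add_le_add (h1 i hne.1) (h1 j hne.2)).trans h2
    exact absurd h3 (by decide)
  have hquad : ∀ i : Fin n, ω (x i.castSucc) (x i.succ) - ω (y i.castSucc) (y i.succ) =
      ω (x i.castSucc) (y i.castSucc) - ω (x i.succ) (y i.succ) := by
    intro i
    have hdeg : x i.castSucc = y i.castSucc ∨ x i.succ = y i.succ ∨
        (x i.castSucc = x i.succ ∧ y i.castSucc = y i.succ) := by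
      obtain ⟨m, rfl⟩ : ∃ m, n = m + 1 := ⟨n - 1, by have := i.pos; omega⟩
      rcases Fin.eq_zero_or_eq_succ i with rfl | ⟨k, rfl⟩
      · -- The point `x 0` moves together with the last point.
        rw [Fin.castSucc_zero, hx0, hy0, ← Fin.succ_last]
        by_cases hl : (0 : Fin (m + 1)) = Fin.last m
        · right; right
          rw [hl]; exact ⟨rfl, rfl⟩
        · rcases huniq _ _ hl with h | h
          · exact .inr (.inl h)
          · exact .inl h
      · rw [← Fin.succ_castSucc]
        rcases huniq k.castSucc k.succ (Fin.castSucc_lt_succ).ne with h | h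
        · exact .inl h
        · exact .inr (.inl h)
    rcases hdeg with h | h | ⟨h1, h2⟩
    · have h3 := hω _ (hxI i.castSucc) _ (hxI i.succ) _ (hyI i.succ) (hx i) (hle i)
        (by rw [h]; exact hy i)
      rw [← h, hω.self (hxI _)]
      linarith
    · have hadj : x i.castSucc = y i.castSucc ∨ triLattice.Adj (x i.castSucc) (y i.castSucc) := by
        obtain ⟨m, rfl⟩ : ∃ m, n = m + 1 := ⟨n - 1, by have := i.pos; omega⟩
        rcases Fin.eq_zero_or_eq_succ i with rfl | ⟨k, rfl⟩
        · rw [Fin.castSucc_zero, hx0, hy0, ← Fin.succ_last]; exact hle _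
        · rw [← Fin.succ_castSucc]; exact hle _
      have h3 := hω _ (hxI i.castSucc) _ (hyI i.castSucc) _ (hyI i.succ) hadj (hy i)
        (by rw [← h]; exact hx i)
      rw [h, hω.self (hyI _)]
      linarith
    · rw [h1, h2, hω.self (hxI _), hω.self (hyI _)]
      ring
  have htel : ∑ i : Fin n, (ω (x i.castSucc) (y i.castSucc) - ω (x i.succ) (y i.succ)) = 0 := by
    have h1 := Fin.sum_univ_succ fun i => ω (x i) (y i)
    have h2 := Fin.sum_univ_castSucc fun i => ω (x i) (y i)
    rw [Finset.sum_sub_distrib]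
    simp only [hx0, hy0] at h1
    linarith
  rw [← sub_eq_zero, curveSum, curveSum, ← Finset.sum_sub_distrib, ← htel]
  exact Finset.sum_congr rfl fun i _ => hquad i

/-- Cocycles sum to zero along closed curves, since they do so along constant curves. -/
lemma IsSimplyConnected.curveSum_eq_zero (hG : IsSimplyConnected G) {ω : ℤ × ℤ → ℤ × ℤ → ℚ}
    (hω : IsCocycle (interior G) ω) {n : ℕ} {x : Fin (n + 1) → ℤ × ℤ} (hx : IsClosedCurve G x) :
    curveSum ω x = 0 := by
  obtain ⟨c, hc⟩ := hG.2 n x hx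
  have key : ∀ y, Relation.ReflTransGen (ElementaryStep G) x y →
      curveSum ω x = curveSum ω y ∧ ∀ i, y i ∈ interior G := by
    intro y hy
    induction hy with
    | refl => exact ⟨rfl, hx.1⟩
    | tail _ hstep ih => exact ⟨ih.1.trans (hstep.curveSum_eq hω), hstep.2.1.1⟩
  obtain ⟨h1, h2⟩ := key _ hc
  rw [h1, curveSum]
  exact Finset.sum_eq_zero fun i _ => hω.self (h2 0)

/-- The sum of a function on pairs along a walk in an induced subgraph. -/
def walkSum (ω : ℤ × ℤ → ℤ × ℤ → ℚ) {S : Set (ℤ × ℤ)} {u v : S}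
    (w : (triLattice.induce S).Walk u v) : ℚ :=
  (w.darts.map fun d => ω d.fst d.snd).sum

lemma walkSum_eq_curveSum (ω : ℤ × ℤ → ℤ × ℤ → ℚ) {S : Set (ℤ × ℤ)} {u v : S}
    (w : (triLattice.induce S).Walk u v) :
    walkSum ω w = curveSum ω fun i : Fin (w.length + 1) => (w.getVert i : ℤ × ℤ) := by
  induction w with
  | nil =>
    simp only [walkSum, SimpleGraph.Walk.darts_nil, List.map_nil, List.sum_nil]
    exact (Fin.sum_univ_zero _).symm
  | cons h p ih =>
    rw [walkSum, SimpleGraph.Walk.darts_cons, List.map_cons, List.sum_cons, ← walkSum, ih, curveSum,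
      curveSum]
    refine Eq.trans ?_ (Fin.sum_univ_succ (n := p.length) _).symm
    simp [SimpleGraph.Walk.getVert_cons_succ]

/-- On a simply connected domain, a cocycle is the gradient of a potential. -/
lemma IsSimplyConnected.exists_potential (hG : IsSimplyConnected G)
    (hconn : (triLattice.induce (interior G)).Preconnected) {ω : ℤ × ℤ → ℤ × ℤ → ℚ}
    (hω : IsCocycle (interior G) ω) :
    ∃ φ : ℤ × ℤ → ℚ, ∀ a ∈ interior G, ∀ b ∈ interior G, triLattice.Adj a b →
      ω a b = φ b - φ a := by
  classical
  by_cases hne : (interior G).Nonempty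
  swap
  · exact ⟨0, fun a ha => (hne ⟨a, ha⟩).elim⟩
  obtain ⟨v, hv⟩ := hne
  have hclosed : ∀ (u : interior G) (w : (triLattice.induce (interior G)).Walk u u),
      walkSum ω w = 0 := by
    intro u w
    rw [walkSum_eq_curveSum]
    refine hG.curveSum_eq_zero hω ⟨fun i => (w.getVert i).2, by simp, fun i => ?_⟩
    exact w.adj_getVert_succ i.2
  have hrev : ∀ (a b : interior G) (w : (triLattice.induce (interior G)).Walk a b),
      walkSum ω w.reverse = -walkSum ω w := by
    intro a b w
    rw [walkSum, SimpleGraph.Walk.darts_reverse, List.map_reverse, List.sum_reverse, List.map_map,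
      walkSum,
      neg_eq_neg_one_mul, ← List.sum_map_mul_left]
    congr 1
    refine List.map_congr_left fun d _ => ?_
    rw [neg_one_mul]
    exact hω.swap d.fst.2 d.snd.2 d.adj
  choose P _ using fun a : interior G => (hconn ⟨v, hv⟩ a).exists_isPath
  refine ⟨fun a => if h : a ∈ interior G then walkSum ω (P ⟨a, h⟩) else 0, ?_⟩
  intro a ha b hb hab
  have hab' : (triLattice.induce (interior G)).Adj ⟨a, ha⟩ ⟨b, hb⟩ := hab
  have h1 := hclosed _ (((P ⟨a, ha⟩).append (.cons hab' .nil)).append (P ⟨b, hb⟩).reverse)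
  have h2 := hrev _ _ (P ⟨b, hb⟩)
  simp only [dif_pos ha, dif_pos hb]
  simp only [walkSum, SimpleGraph.Walk.darts_append, List.map_append, List.sum_append,
    SimpleGraph.Walk.darts_cons, SimpleGraph.Walk.darts_nil, List.map_cons, List.map_nil,
    List.sum_cons, List.sum_nil] at h1 h2 ⊢
  linarith

/-! ### The shape of smooth domains -/

lemma mem_sphere_one {p q : ℤ × ℤ} : q ∈ (sphere G p 1).verts ↔ G.Adj p q := by
  change (q ∈ G.verts ∧ G.spanningCoe.edist p q = ((1 : ℕ) : ℕ∞)) ↔ _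
  rw [Nat.cast_one, SimpleGraph.edist_eq_one_iff_adj, SimpleGraph.Subgraph.spanningCoe_adj]
  exact ⟨fun h => h.2, fun h => ⟨h.snd_mem, h⟩⟩

lemma sphere_one_adj {p q r : ℤ × ℤ} :
    (sphere G p 1).Adj q r ↔ G.Adj p q ∧ G.Adj p r ∧ G.Adj q r := by
  rw [← mem_sphere_one (G := G) (q := q), ← mem_sphere_one (G := G) (q := r)]
  rfl

namespace IsDomain

lemma adj_iff (hD : IsDomain G) {p q : ℤ × ℤ} :
    G.Adj p q ↔ p ∈ G.verts ∧ q ∈ G.verts ∧ triLattice.Adj p q :=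
  ⟨fun h => ⟨h.fst_mem, h.snd_mem, h.adj_sub⟩, fun h => hD.edge_of_dist_one _ h.1 _ h.2.1 h.2.2⟩

/-- As domains are induced subgraphs, the edges of the unit spheres play no role for interiority. -/
lemma mem_interior_iff (hD : IsDomain G) {p : ℤ × ℤ} :
    p ∈ interior G ↔ p ∈ G.verts ∧ ∀ q, triLattice.Adj p q → q ∈ G.verts := by
  refine and_congr_right fun hp => ⟨fun h q hq => ?_, fun h => ?_⟩
  · have : q ∈ (sphere ⊤ p 1).verts := mem_sphere_one.2 hq
    rw [← h, mem_sphere_one] at this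
    exact this.snd_mem
  · have hadj : ∀ q, triLattice.Adj p q → G.Adj p q := fun q hq => hD.adj_iff.2 ⟨hp, h q hq, hq⟩
    refine SimpleGraph.Subgraph.ext (Set.ext fun q => ?_) (funext₂ fun q r => propext ?_)
    · rw [mem_sphere_one, mem_sphere_one]
      exact ⟨fun h => h.adj_sub, hadj q⟩
    · rw [sphere_one_adj, sphere_one_adj]
      exact ⟨fun ⟨h1, h2, h3⟩ => ⟨h1.adj_sub, h2.adj_sub, h3.adj_sub⟩, fun ⟨h1, h2, h3⟩ =>
        ⟨hadj _ h1, hadj _ h2, hD.adj_iff.2 ⟨h q h1, h r h2, h3⟩⟩⟩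

/-- In a domain every edge lies in a triangle. -/
lemma exists_triangle (hD : IsDomain G) {p q : ℤ × ℤ} (h : G.Adj p q) :
    ∃ r, G.Adj p r ∧ G.Adj q r := by
  obtain ⟨r, hr⟩ := ((hD.two_dim p h.fst_mem).2 q (mem_sphere_one.2 h)).1
  obtain ⟨-, h2, h3⟩ := sphere_one_adj.1 (mem_sphere_one.1 hr)
  exact ⟨r, h2, h3⟩

/-- The boundary points of a domain span no triangle. -/
lemma no_boundary_triangle (hD : IsDomain G) {p q r : ℤ × ℤ} (hp : p ∈ boundary G)
    (hq : q ∈ boundary G) (hr : r ∈ boundary G) (hpq : G.Adj p q) (hpr : G.Adj p r)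
    (hqr : G.Adj q r) : False := by
  have h1 : (G.induce (boundary G)).Adj p q := ⟨hp, hq, hpq⟩
  have h2 : (G.induce (boundary G)).Adj p r := ⟨hp, hr, hpr⟩
  have h3 : (G.induce (boundary G)).Adj q r := ⟨hq, hr, hqr⟩
  exact (hD.boundary_one_dim p hp).2 q (mem_sphere_one.2 h1) r (sphere_one_adj.2 ⟨h1, h2, h3⟩)

end IsDomain

namespace IsSmoothDomain

lemma verts_eq (hG : IsSmoothDomain G) : G.verts = interior G ∪ boundary G :=
  Set.Subset.antisymm (fun p hp => hG.1.interior_or_boundary p hp)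
    (Set.union_subset (fun _ h => h.1) (fun _ h => h.1))

/-- Smoothness forces every boundary point to be a boundary point of the complement. -/
lemma exists_outer_neighbor (hG : IsSmoothDomain G) {p : ℤ × ℤ} (hp : p ∈ boundary G) :
    ∃ q, triLattice.Adj p q ∧ q ∉ G.verts := by
  have hp' : p ∉ interior (complement G) := fun h => by
    obtain ⟨q, hq, hpq⟩ := hp.2.2
    exact (hG.2.mem_interior_iff.1 h).2 q hpq.adj_sub hq
  obtain ⟨q, hq, hpq⟩ := ((hG.2.interior_or_boundary p hp.2.1).resolve_left hp').2.2
  refine ⟨q, hpq.adj_sub, fun hqG => ?_⟩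
  obtain ⟨hq1, hq2⟩ := hG.2.mem_interior_iff.1 hq
  rcases hG.1.interior_or_boundary q hqG with h | h
  · exact hq1 h
  · obtain ⟨r, hr, hqr⟩ := h.2.2
    exact hq2 r hqr.adj_sub hr

/-- Adjacent boundary points have a common interior neighbour. -/
lemma exists_common_interior (hG : IsSmoothDomain G) {p q : ℤ × ℤ} (hp : p ∈ boundary G)
    (hq : q ∈ boundary G) (hpq : G.Adj p q) : ∃ r ∈ interior G, G.Adj p r ∧ G.Adj q r := by
  obtain ⟨r, hpr, hqr⟩ := hG.1.exists_triangle hpq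
  refine ⟨r, (hG.1.interior_or_boundary r hpr.snd_mem).resolve_right fun hr => ?_, hpr, hqr⟩
  exact hG.1.no_boundary_triangle hp hq hr hpq hpr hqr

/-- Adjacent boundary points have a common neighbour outside the domain: in the complement their
edge lies in a triangle, whose third vertex is not a boundary point. -/
lemma exists_common_outer (hG : IsSmoothDomain G) {p q : ℤ × ℤ} (hp : p ∈ boundary G)
    (hq : q ∈ boundary G) (hpq : G.Adj p q) :
    ∃ r, r ∉ G.verts ∧ triLattice.Adj p r ∧ triLattice.Adj q r := by
  obtain ⟨r, hpr, hqr⟩ := hG.2.exists_triangle (p := p) (q := q) ⟨hp.2.1, hq.2.1, hpq.adj_sub⟩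
  refine ⟨r, fun hr => ?_, hpr.adj_sub, hqr.adj_sub⟩
  have hr' := (hG.1.interior_or_boundary r hr).resolve_left hpr.snd_mem
  exact hG.1.no_boundary_triangle hp hq hr' hpq (hG.1.adj_iff.2 ⟨hp.1, hr, hpr.adj_sub⟩)
    (hG.1.adj_iff.2 ⟨hq.1, hr, hqr.adj_sub⟩)

/-- An edge between boundary points has only two common neighbours in the lattice; one of them is
interior and the other one is outer. -/
lemma isFrontier (hG : IsSmoothDomain G) {I B : Finset (ℤ × ℤ)} (hI : (I : Set _) = interior G)
    (hB : (B : Set _) = boundary G) : IsFrontier I B := by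
  have mI : ∀ p, p ∈ I ↔ p ∈ interior G := fun p => by rw [← hI]; rfl
  have mB : ∀ p, p ∈ B ↔ p ∈ boundary G := fun p => by rw [← hB]; rfl
  have mV : ∀ p, p ∉ G.verts → p ∉ I ∧ p ∉ B := fun p hp =>
    ⟨fun h => hp ((mI p).1 h).1, fun h => hp ((mB p).1 h).1⟩
  refine ⟨fun p hp h => ((mB p).1 hp).2.1 ((mI p).1 h), fun p hp j => ?_, fun p hp => ?_,
    fun p hp => ?_, fun p hp j hj => ?_⟩
  · rw [mI, mB]
    exact hG.1.interior_or_boundary _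
      ((hG.1.mem_interior_iff.1 ((mI p).1 hp)).2 _ (adj_add_dir p j))
  · obtain ⟨q, hq, hpq⟩ := ((mB p).1 hp).2.2
    obtain ⟨j, rfl⟩ := triLattice_adj_iff.1 hpq.adj_sub
    exact ⟨j, (mI _).2 hq⟩
  · obtain ⟨q, hpq, hq⟩ := hG.exists_outer_neighbor ((mB p).1 hp)
    obtain ⟨j, rfl⟩ := triLattice_adj_iff.1 hpq
    exact ⟨j, mV _ hq⟩
  · have hp' := (mB _).1 hp
    have hj' := (mB _).1 hj
    have hadj : G.Adj p (p + dir j) := hG.1.adj_iff.2 ⟨hp'.1, hj'.1, adj_add_dir p j⟩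
    obtain ⟨r, hr, hpr, hqr⟩ := hG.exists_common_interior hp' hj' hadj
    obtain ⟨s, hs, hps, hqs⟩ := hG.exists_common_outer hp' hj' hadj
    rcases common_neighbor hpr.adj_sub hqr.adj_sub with rfl | rfl <;>
      rcases common_neighbor hps hqs with rfl | rfl
    · exact absurd hr.1 hs
    · exact .inl ⟨(mI _).2 hr, mV _ hs⟩
    · exact .inr ⟨(mI _).2 hr, mV _ hs⟩
    · exact absurd hr.1 hs

/-- The interior of a connected smooth domain is connected: a path through boundary points can be
pushed to their interior neighbours. -/
lemma interior_preconnected (hG : IsSmoothDomain G) (hconn : G.Connected) :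
    (triLattice.induce (interior G)).Preconnected := by
  set H := triLattice.induce (interior G) with hH
  intro u v
  have key : ∀ (p q : G.verts) (_ : G.coe.Walk p q),
      ((∀ hp : (p : ℤ × ℤ) ∈ interior G, H.Reachable u ⟨p, hp⟩) ∧
        ∀ r (hr : r ∈ interior G), G.Adj p r → H.Reachable u ⟨r, hr⟩) →
      ((∀ hq : (q : ℤ × ℤ) ∈ interior G, H.Reachable u ⟨q, hq⟩) ∧
        ∀ r (hr : r ∈ interior G), G.Adj q r → H.Reachable u ⟨r, hr⟩) := by
    intro p q w
    induction w with
    | nil => exact id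
    | @cons p q _ hpq _ ih =>
      refine fun hp => ih ?_
      have hpq : G.Adj p q := hpq
      have hadj : ∀ {a b} (ha : a ∈ interior G) (hb : b ∈ interior G), G.Adj a b →
          H.Reachable ⟨a, ha⟩ ⟨b, hb⟩ := fun ha hb hab =>
        SimpleGraph.Adj.reachable (show H.Adj _ _ from hab.adj_sub)
      by_cases hq : (q : ℤ × ℤ) ∈ interior G
      · exact ⟨fun _ => hp.2 q hq hpq, fun r hr hqr => (hp.2 q hq hpq).trans (hadj hq hr hqr)⟩
      · have hqB := (hG.1.interior_or_boundary q q.2).resolve_left hq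
        obtain ⟨s, hs, hqs, hus⟩ : ∃ s, ∃ hs : s ∈ interior G, G.Adj q s ∧
            H.Reachable u ⟨s, hs⟩ := by
          rcases hG.1.interior_or_boundary p p.2 with hpI | hpB
          · exact ⟨p, hpI, hpq.symm, hp.1 hpI⟩
          · obtain ⟨s, hs, hps, hqs⟩ := hG.exists_common_interior hpB hqB hpq
            exact ⟨s, hs, hqs, hp.2 s hs hps⟩
        refine ⟨fun h => absurd h hq, fun r hr hqr => ?_⟩
        by_cases hsr : s = r
        · subst hsr; exact hus
        rcases hG.1.interior_link s hs r hr hsr ⟨q, hqB, hqs, hqr⟩ with h | ⟨t, ht, h1, h2⟩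
        · exact hus.trans (hadj hs hr h)
        · exact (hus.trans (hadj hs ht h1)).trans (hadj ht hr h2.symm)
  obtain ⟨w⟩ := hconn.preconnected ⟨u, u.2.1⟩ ⟨v, v.2.1⟩
  refine (key _ _ w ⟨fun _ => SimpleGraph.Reachable.refl _, fun r hr hur => ?_⟩).1 v.2
  exact SimpleGraph.Adj.reachable (show H.Adj _ _ from hur.adj_sub)

end IsSmoothDomain

/-! ### Arc lengths of the spheres of radius one and two -/

/-- Counting the edges of a subgraph with an injective enumeration `e` of candidates. -/
lemma ncard_edgeSet_eq_sum {V ι : Type*} {H : SimpleGraph V} [Fintype ι] (K : H.Subgraph)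
    {e : ι → Sym2 V} (he : Function.Injective e) (P : ι → Prop) [DecidablePred P]
    (h1 : ∀ i, P i → e i ∈ K.edgeSet) (h2 : ∀ a b, K.Adj a b → ∃ i, P i ∧ e i = s(a, b)) :
    (K.edgeSet.ncard : ℤ) = ∑ i, if P i then 1 else 0 := by
  have : K.edgeSet = e '' ((Finset.univ.filter P : Finset ι) : Set ι) := by
    ext x
    constructor
    · induction x with
      | h a b =>
        intro hx
        obtain ⟨i, hi, hx⟩ := h2 a b hx
        exact ⟨i, by simpa using hi, hx⟩
    · rintro ⟨i, hi, rfl⟩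
      exact h1 i (by simpa using hi)
  rw [this, Set.ncard_image_of_injective _ he, Set.ncard_coe_finset, Finset.card_filter]
  push_cast
  rfl

/-- The edges of `S₁(p)` are the sides of the hexagon around `p` with both ends in `G`. -/
lemma IsDomain.arcLength_one (hD : IsDomain G) {V : Finset (ℤ × ℤ)} (hV : (V : Set _) = G.verts)
    {p : ℤ × ℤ} (hp : p ∈ G.verts) :
    (arcLength G p 1 : ℤ) = ∑ j, ind V (p + dir j) * ind V (p + dir (j + 1)) := by
  have mV : ∀ q, q ∈ G.verts ↔ q ∈ V := fun q => by rw [← hV]; rfl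
  rw [arcLength, ncard_edgeSet_eq_sum (sphere G p 1)
    (e := fun j : Fin 6 => s(p + dir j, p + dir (j + 1)))
    (P := fun j => p + dir j ∈ V ∧ p + dir (j + 1) ∈ V)]
  · simp only [ind, ite_zero_mul_ite_zero, mul_one]
  · intro j k hjk
    simp only [Sym2.eq_iff, add_right_inj, dir_injective.eq_iff] at hjk
    rcases hjk with h | ⟨h1, h2⟩
    · exact h.1
    · exact absurd (h1 ▸ h2) (by clear h1 h2; revert k; decide)
  · rintro j ⟨h1, h2⟩
    rw [← mV] at h1 h2
    exact sphere_one_adj.2 ⟨hD.adj_iff.2 ⟨hp, h1, adj_add_dir _ _⟩,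
      hD.adj_iff.2 ⟨hp, h2, adj_add_dir _ _⟩, hD.adj_iff.2 ⟨h1, h2, adj_dir_succ _ _⟩⟩
  · intro a b hab
    obtain ⟨ha, hb, hab⟩ := sphere_one_adj.1 hab
    obtain ⟨j, rfl⟩ := triLattice_adj_iff.1 ha.adj_sub
    rcases common_neighbor hb.adj_sub hab.adj_sub with rfl | rfl
    · exact ⟨j, ⟨(mV _).1 ha.snd_mem, (mV _).1 hb.snd_mem⟩, rfl⟩
    · refine ⟨j - 1, ?_, ?_⟩
      · rw [sub_add_cancel]
        exact ⟨(mV _).1 hb.snd_mem, (mV _).1 ha.snd_mem⟩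
      · rw [sub_add_cancel]
        exact Sym2.eq_swap

/-- The neighbour of an index in the cyclic order on one of the two sides. -/
def beside (j : Fin 6) (b : Bool) : Fin 6 := if b then j + 1 else j - 1

/-- A point is at distance two from `p` in a domain if it is at the end of a path of length two and
is neither `p` nor a lattice neighbour of `p`, since domains are induced subgraphs. -/
lemma IsDomain.mem_sphere_two (hD : IsDomain G) {p q : ℤ × ℤ} (hp : p ∈ G.verts) :
    q ∈ (sphere G p 2).verts ↔ ∃ j k, q = p + dir j + dir k ∧ p + dir j ∈ G.verts ∧
      q ∈ G.verts ∧ dir j + dir k ≠ 0 ∧ ∀ m, dir j + dir k ≠ dir m := by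
  change (q ∈ G.verts ∧ G.spanningCoe.edist p q = ((2 : ℕ) : ℕ∞)) ↔ _
  rw [Nat.cast_two, SimpleGraph.edist_eq_two_iff]
  constructor
  · rintro ⟨hq, hne, hadj, w, hpw, hqw⟩
    have hpw : G.Adj p w := hpw
    have hqw : G.Adj q w := hqw
    obtain ⟨j, rfl⟩ := triLattice_adj_iff.1 hpw.adj_sub
    obtain ⟨k, rfl⟩ := triLattice_adj_iff.1 hqw.symm.adj_sub
    refine ⟨j, k, rfl, hpw.snd_mem, hq, fun h => hne ?_, fun m hm => hadj ?_⟩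
    · rw [add_assoc, h, add_zero]
    · rw [SimpleGraph.Subgraph.spanningCoe_adj]
      exact hD.adj_iff.2 ⟨hp, hq, by rw [add_assoc, hm]; exact adj_add_dir p m⟩
  · rintro ⟨j, k, rfl, hj, hq, hne, hadj⟩
    refine ⟨hq, fun h => hne ?_, fun h => ?_, p + dir j,
      hD.adj_iff.2 ⟨hp, hj, adj_add_dir p j⟩, (hD.adj_iff.2 ⟨hj, hq, adj_add_dir _ k⟩).symm⟩
    · rw [add_assoc, left_eq_add] at h
      exact h
    · have h : G.Adj p (p + dir j + dir k) := h
      obtain ⟨m, hm⟩ := triLattice_adj_iff.1 h.adj_sub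
      rw [add_assoc, add_right_inj] at hm
      exact hadj m hm

set_option synthInstance.maxSize 1000 in
/-- An edge of the sphere of radius two in the lattice joins a point `2 • dir j` to a point
`dir j + dir (j ± 1)`. -/
lemma second_ring_edge : ∀ i k i' k' : Fin 6, (∃ l, dir i' + dir k' = dir i + dir k + dir l) →
    dir i + dir k ≠ 0 → dir i' + dir k' ≠ 0 → (∀ m, dir i + dir k ≠ dir m) →
    (∀ m, dir i' + dir k' ≠ dir m) →
    (k = i ∧ ∃ b, dir i' + dir k' = dir i + dir (beside i b)) ∨
    (k' = i' ∧ ∃ b, dir i + dir k = dir i' + dir (beside i' b)) := by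
  decide +kernel

/-- The edges of the sphere of radius two in the lattice are enumerated without repetition. -/
lemma second_ring_injective : Function.Injective fun i : Fin 6 × Bool =>
    s(dir i.1 + dir i.1, dir i.1 + dir (beside i.1 i.2)) := by
  decide +kernel

/-- The points of the sphere of radius two in the lattice are at distance at least two. -/
lemma second_ring_far : ∀ j : Fin 6, ∀ k, (k = j ∨ ∃ b, k = beside j b) →
    dir j + dir k ≠ 0 ∧ ∀ m, dir j + dir k ≠ dir m := by
  decide

/-- The edges of `S₂(p)` are the sides `{p + 2 • dir j, p + dir j + dir (j ± 1)}` of the dodecagon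
around `p` which span a triangle of `G` with `p + dir j`. No further condition is needed for the
ends to have distance two from `p` in `G`, because `p + dir j` is a common neighbour. -/
lemma IsDomain.arcLength_two (hD : IsDomain G) {V : Finset (ℤ × ℤ)} (hV : (V : Set _) = G.verts)
    {p : ℤ × ℤ} (hp : p ∈ G.verts) :
    (arcLength G p 2 : ℤ) = ∑ j, ind V (p + dir j) * (ind V (p + dir j + dir j) *
      (ind V (p + dir j + dir (j + 1)) + ind V (p + dir j + dir (j - 1)))) := by
  have mV : ∀ q, q ∈ G.verts ↔ q ∈ V := fun q => by rw [← hV]; rfl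
  rw [arcLength, ncard_edgeSet_eq_sum (sphere G p 2)
    (e := fun i : Fin 6 × Bool => s(p + dir i.1 + dir i.1, p + dir i.1 + dir (beside i.1 i.2)))
    (P := fun i => p + dir i.1 ∈ V ∧ p + dir i.1 + dir i.1 ∈ V ∧
      p + dir i.1 + dir (beside i.1 i.2) ∈ V)]
  · rw [Fintype.sum_prod_type]
    refine Finset.sum_congr rfl fun j _ => ?_
    rw [Fintype.sum_bool]
    simp only [beside, ind, ite_and]
    split_ifs <;> simp_all
  · have h := (Sym2.map.injective (add_right_injective p)).comp second_ring_injective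
    convert h using 2 with i
    simp [add_assoc]
  · rintro ⟨j, b⟩ ⟨h1, h2, h3⟩
    rw [← mV] at h1 h2 h3
    refine ⟨(hD.mem_sphere_two hp).2 ⟨j, j, rfl, h1, h2, second_ring_far j j (.inl rfl)⟩,
      (hD.mem_sphere_two hp).2 ⟨j, _, rfl, h1, h3, second_ring_far j _ (.inr ⟨b, rfl⟩)⟩,
      hD.adj_iff.2 ⟨h2, h3, ?_⟩⟩
    cases b
    · exact adj_dir_pred _ j
    · exact adj_dir_succ _ j
  · rintro a b ⟨ha, hb, hab⟩
    obtain ⟨i, k, rfl, hi, ha, h0, hm⟩ := (hD.mem_sphere_two hp).1 ha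
    obtain ⟨i', k', rfl, hi', hb, h0', hm'⟩ := (hD.mem_sphere_two hp).1 hb
    obtain ⟨l, hl⟩ := triLattice_adj_iff.1 hab.adj_sub
    simp only [mV] at ha hb hi hi'
    simp only [add_assoc p] at hl ha hb ⊢
    rw [add_right_inj] at hl
    rcases second_ring_edge i k i' k' ⟨l, hl⟩ h0 h0' hm hm' with ⟨rfl, c, hc⟩ | ⟨rfl, c, hc⟩
    · rw [hc] at hb ⊢
      exact ⟨(k, c), ⟨hi, ha, hb⟩, rfl⟩
    · rw [hc] at ha ⊢
      exact ⟨(k', c), ⟨hi', hb, ha⟩, Sym2.eq_swap⟩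

end TriDomain

/-! ### The sum of the curvatures -/

open TriDomain in
theorem mainTheorem1 (G : triLattice.Subgraph) (hfin : G.verts.Finite)
    (hsmooth : TriDomain.IsSmoothDomain G) (hsc : TriDomain.IsSimplyConnected G) :
    ∑ᶠ p ∈ TriDomain.boundary G, TriDomain.curvature G p = 12 := by
  obtain ⟨I, hI⟩ := (hfin.subset fun p (hp : p ∈ interior G) => hp.1).exists_finset_coe
  obtain ⟨B, hB⟩ := (hfin.subset fun p (hp : p ∈ boundary G) => hp.1).exists_finset_coe
  have hV : ((I ∪ B : Finset (ℤ × ℤ)) : Set (ℤ × ℤ)) = G.verts := by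
    rw [Finset.coe_union, hI, hB, hsmooth.verts_eq]
  have hF := hsmooth.isFrontier hI hB
  have hconn := hsmooth.interior_preconnected hsc.1
  have hne : I.Nonempty := by
    rw [← Finset.coe_nonempty, hI]
    obtain ⟨p, hp⟩ := hsc.1.nonempty
    rcases hsmooth.1.interior_or_boundary p hp with h | h
    · exact ⟨p, h⟩
    · obtain ⟨q, hq, -⟩ := h.2.2
      exact ⟨q, hq⟩
  have hchi := euler_characteristic hne
    (fun φ hφ a ha b hb => by
      have mI : ∀ p ∈ interior G, p ∈ I := fun p hp => by rwa [← hI] at hp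
      obtain ⟨w⟩ := hconn ⟨a, hI ▸ ha⟩ ⟨b, hI ▸ hb⟩
      have key : ∀ (u v : interior G) (_ : (triLattice.induce (interior G)).Walk u v),
          φ u = φ v := by
        intro u v w
        induction w with
        | nil => rfl
        | cons h _ ih => exact (hφ _ (mI _ (Subtype.prop _)) _ (mI _ (Subtype.prop _)) h).trans ih
      exact key _ _ w)
    (fun ω hω => by
      rw [hI] at hω
      obtain ⟨φ, hφ⟩ := hsc.exists_potential hconn hω
      exact ⟨φ, fun a ha b hb => hφ a (hI ▸ ha) b (hI ▸ hb)⟩)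
  -- Together with the Euler characteristic these two counts give
  -- `∑ p ∈ B, (2 - inNbrs I p) = 6`, and the sum of the curvatures is twice this number.
  have hE := (two_mul_card_edges I).trans hF.sum_inNbrs
  have hT := (three_mul_card_triangles I).trans hF.sum_triangles
  rw [← hB, finsum_mem_coe_finset]
  have hmem : ∀ p ∈ B, p ∈ G.verts := fun p hp => by
    rw [← hV]; exact Finset.mem_coe.2 (Finset.mem_union_right _ hp)
  have h1 : ∑ p ∈ B, (arcLength G p 1 : ℤ) = ∑ p ∈ B, inNbrs I p + B.card := by
    rw [Finset.sum_congr rfl fun p hp => (hsmooth.1.arcLength_one hV (hmem p hp)).trans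
      (hF.link_identities hp).1, Finset.sum_add_distrib]
    simp
  have h2 : ∑ p ∈ B, (arcLength G p 2 : ℤ) = 4 * ∑ p ∈ B, inNbrs I p - 2 * (B.card : ℤ) := by
    rw [← hF.sum_second_sphere]
    exact Finset.sum_congr rfl fun p hp => hsmooth.1.arcLength_two hV (hmem p hp)
  simp only [curvature, Finset.sum_sub_distrib, ← Finset.mul_sum, h1, h2]
  zify at hchi
  linarith
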